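/- Let $k$ be a field, $K/k$ a finite separable field extension, $L/k$ the Galois closure of $K/k$, $G=\mathrm{Gal}(L/k)$ and $H=\mathrm{Gal}(L/K)\leq G$. Let $p\geq 3$ be a prime number and assume that $$G=E_p(p^3)=\langle a,b,c\mid a^p=b^p=c^p=1,\ [b,a]=c,\ [c,a]=1,\ [c,b]=1\rangle,\qquad [x,y]=x^{-1}y^{-1}xy,$$ is the Heisenberg group of order $p^3$. Let $J_{G/H}=\mathrm{Hom}_{\mathbb Z}(I_{G/H},\mathbb Z)$ be the dual of the kernel $I_{G/H}$ of the augmentation $\mathbb Z[G/H]\to\mathbb Z$, write $J_G$ for $J_{G/H}$ when $H=\{1\}$, and let $\delta:H^2(G,J_{G/H})\to H^3(G,\mathbb Z)$ be the connecting homomorphism of the exact sequence $0\to\mathbb Z\to\mathbb Z[G/H]\to J_{G/H}\to 0$ (where $1\in\mathbb Z$ is sent to the sum of all cosets, and the second map is dual to the inclusion $I_{G/H}\subset\mathbb Z[G/H]$). Let $M(G)=H^2(G,\mathbb C^\times)$ (trivial action) be the Schur multiplier of $G$, and for a $G$-module $A$ let $$Ш^2_\omega(G,A)=\bigcap_{C\leq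 G\text{ cyclic}}\mathrm{Ker}\{\mathrm{res}:H^2(G,A)\to H^2(C,A)\}.$$ Then $Z(G)=\langle c\rangle\simeq C_p$, and either $H=\{1\}$, or $H\simeq C_p$ with $H\neq Z(G)$. Moreover: (1) When $H=\{1\}$, one has $Ш^2_\omega(G,J_G)=H^2(G,J_G)$, the map $\delta: H^2(G,J_G)\to H^3(G,\mathbb Z)$ is an isomorphism, and $H^3(G,\mathbb Z)\simeq M(G)\simeq(\mathbb Z/p\mathbb Z)^{\oplus 2}$. (2) When $H\simeq C_p$ with $H\neq Z(G)$, the map $\delta:H^2(G,J_{G/H})\to H^3(G,\mathbb Z)$ is an isomorphism, and $H^3(G,\mathbb Z)\simeq M(G)\simeq(\mathbb Z/p\mathbb Z)^{\oplus 2}$. -/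

import Mathlib

open CategoryTheory
open scoped MonoidAlgebra

namespace HeisenbergHNP

noncomputable section

/-! ### The Heisenberg group `E_p(p³)` -/

/-- The three generators of the Heisenberg group. -/
inductive HeisGen
  | a
  | b
  | c

/-- The defining relators `a^p, b^p, c^p, [b,a]c⁻¹, [c,a], [c,b]`, with the commutator convention
`[x,y] = x⁻¹y⁻¹xy`. -/
def heisRels (p : ℕ) : Set (FreeGroup HeisGen) :=
  let a := FreeGroup.of HeisGen.a
  let b := FreeGroup.of HeisGen.b
  let c := FreeGroup.of HeisGen.c
  {a ^ p, b ^ p, c ^ p,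
    (b⁻¹ * a⁻¹ * b * a) * c⁻¹, c⁻¹ * a⁻¹ * c * a, c⁻¹ * b⁻¹ * c * b}

/-- `E_p(p³) = ⟨a, b, c ∣ a^p = b^p = c^p = 1, [b,a] = c, [c,a] = 1, [c,b] = 1⟩`. -/
abbrev Heis (p : ℕ) : Type := PresentedGroup (heisRels p)

/-- The generator `a` of `E_p(p³)`. -/
def Heis.a (p : ℕ) : Heis p := PresentedGroup.of HeisGen.a
/-- The generator `b` of `E_p(p³)`. -/
def Heis.b (p : ℕ) : Heis p := PresentedGroup.of HeisGen.b
/-- The generator `c` of `E_p(p³)`. -/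
def Heis.c (p : ℕ) : Heis p := PresentedGroup.of HeisGen.c

theorem Heis.a_pow (p : ℕ) : Heis.a p ^ p = 1 :=
  PresentedGroup.one_of_mem (x := FreeGroup.of HeisGen.a ^ p) (by simp [heisRels])

theorem Heis.b_pow (p : ℕ) : Heis.b p ^ p = 1 :=
  PresentedGroup.one_of_mem (x := FreeGroup.of HeisGen.b ^ p) (by simp [heisRels])

theorem Heis.c_pow (p : ℕ) : Heis.c p ^ p = 1 :=
  PresentedGroup.one_of_mem (x := FreeGroup.of HeisGen.c ^ p) (by simp [heisRels])

theorem Heis.ba (p : ℕ) : Heis.b p * Heis.a p = Heis.a p * Heis.b p * Heis.c p := by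
  have h : (Heis.b p)⁻¹ * (Heis.a p)⁻¹ * Heis.b p * Heis.a p * (Heis.c p)⁻¹ = 1 :=
    PresentedGroup.one_of_mem (rels := heisRels p)
      (x := ((FreeGroup.of HeisGen.b)⁻¹ * (FreeGroup.of HeisGen.a)⁻¹ * FreeGroup.of HeisGen.b *
        FreeGroup.of HeisGen.a) * (FreeGroup.of HeisGen.c)⁻¹) (by simp [heisRels])
  rw [mul_inv_eq_one] at h
  rw [← h]; group

theorem Heis.ca (p : ℕ) : Heis.c p * Heis.a p = Heis.a p * Heis.c p := by
  have h : (Heis.c p)⁻¹ * (Heis.a p)⁻¹ * Heis.c p * Heis.a p = 1 :=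
    PresentedGroup.one_of_mem (rels := heisRels p)
      (x := (FreeGroup.of HeisGen.c)⁻¹ * (FreeGroup.of HeisGen.a)⁻¹ * FreeGroup.of HeisGen.c *
        FreeGroup.of HeisGen.a) (by simp [heisRels])
  calc Heis.c p * Heis.a p = Heis.a p * Heis.c p *
        ((Heis.c p)⁻¹ * (Heis.a p)⁻¹ * Heis.c p * Heis.a p) := by group
    _ = _ := by rw [h, mul_one]

theorem Heis.cb (p : ℕ) : Heis.c p * Heis.b p = Heis.b p * Heis.c p := by
  have h : (Heis.c p)⁻¹ * (Heis.b p)⁻¹ * Heis.c p * Heis.b p = 1 :=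
    PresentedGroup.one_of_mem (rels := heisRels p)
      (x := (FreeGroup.of HeisGen.c)⁻¹ * (FreeGroup.of HeisGen.b)⁻¹ * FreeGroup.of HeisGen.c *
        FreeGroup.of HeisGen.b) (by simp [heisRels])
  calc Heis.c p * Heis.b p = Heis.b p * Heis.c p *
        ((Heis.c p)⁻¹ * (Heis.b p)⁻¹ * Heis.c p * Heis.b p) := by group
    _ = _ := by rw [h, mul_one]

theorem Heis.b_mul_a_pow (p i : ℕ) :
    Heis.b p * Heis.a p ^ i = Heis.a p ^ i * (Heis.b p * Heis.c p ^ i) := by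
  have hc : ∀ j : ℕ, Heis.c p ^ j * Heis.a p = Heis.a p * Heis.c p ^ j := fun j =>
    ((show Commute (Heis.c p) (Heis.a p) from Heis.ca p).pow_left j).eq
  induction i with
  | zero => simp
  | succ i ih =>
    calc Heis.b p * Heis.a p ^ (i + 1)
        = Heis.b p * Heis.a p ^ i * Heis.a p := by rw [pow_succ, mul_assoc]
      _ = Heis.a p ^ i * (Heis.b p * (Heis.c p ^ i * Heis.a p)) := by
          rw [ih]; simp only [mul_assoc]
      _ = Heis.a p ^ i * (Heis.b p * Heis.a p * Heis.c p ^ i) := by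
          rw [hc]; simp only [mul_assoc]
      _ = Heis.a p ^ (i + 1) * (Heis.b p * Heis.c p ^ (i + 1)) := by
          rw [Heis.ba, pow_succ, pow_succ']; simp only [mul_assoc]

instance Heis.finite (p : ℕ) [NeZero p] : Finite (Heis p) := by
  have hp : 0 < p := Nat.pos_of_ne_zero (NeZero.ne p)
  have hfin : ∀ x : Heis p, x ^ p = 1 → (Set.range fun n : ℕ => x ^ n).Finite := by
    intro x hx
    refine (Set.finite_range fun i : Fin p => x ^ (i : ℕ)).subset ?_
    rintro _ ⟨n, rfl⟩
    refine ⟨⟨n % p, Nat.mod_lt _ hp⟩, ?_⟩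
    change x ^ (n % p) = x ^ n
    conv_rhs => rw [← Nat.mod_add_div n p, pow_add, pow_mul, hx, one_pow, mul_one]
  let S : Set (Heis p) := Set.image2 (fun x y => x * y) (Set.range fun n : ℕ => Heis.a p ^ n)
    (Set.image2 (fun x y => x * y) (Set.range fun n : ℕ => Heis.b p ^ n)
      (Set.range fun n : ℕ => Heis.c p ^ n))
  have hS : S.Finite := Set.Finite.image2 _ (hfin _ (Heis.a_pow p))
    (Set.Finite.image2 _ (hfin _ (Heis.b_pow p)) (hfin _ (Heis.c_pow p)))
  have hmem : ∀ i j l : ℕ, Heis.a p ^ i * (Heis.b p ^ j * Heis.c p ^ l) ∈ S := fun i j l =>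
    ⟨_, ⟨i, rfl⟩, _, ⟨_, ⟨j, rfl⟩, _, ⟨l, rfl⟩, rfl⟩, rfl⟩
  have hca : Commute (Heis.c p) (Heis.a p) := Heis.ca p
  have hcb : Commute (Heis.c p) (Heis.b p) := Heis.cb p
  have hgen : ∀ (t : HeisGen) (x : Heis p), x ∈ S →
      (PresentedGroup.of t : Heis p) * x ∈ S := by
    rintro t _ ⟨_, ⟨i, rfl⟩, _, ⟨_, ⟨j, rfl⟩, _, ⟨l, rfl⟩, rfl⟩, rfl⟩
    cases t with
    | a =>
      have := hmem (i + 1) j l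
      rw [pow_succ', mul_assoc] at this
      exact this
    | b =>
      have := hmem i (j + 1) (i + l)
      have e : Heis.b p * (Heis.a p ^ i * (Heis.b p ^ j * Heis.c p ^ l)) =
          Heis.a p ^ i * (Heis.b p ^ (j + 1) * Heis.c p ^ (i + l)) := by
        rw [← mul_assoc, Heis.b_mul_a_pow, pow_succ', pow_add]
        have := (hcb.pow_pow i j).eq
        simp only [mul_assoc]
        rw [← mul_assoc (Heis.c p ^ i), this]
        simp only [mul_assoc]
      exact e ▸ this
    | c =>
      have := hmem i j (l + 1)
      have e : Heis.c p * (Heis.a p ^ i * (Heis.b p ^ j * Heis.c p ^ l)) =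
          Heis.a p ^ i * (Heis.b p ^ j * Heis.c p ^ (l + 1)) := by
        rw [← mul_assoc, (hca.pow_right i).eq, mul_assoc, ← mul_assoc (Heis.c p),
          (hcb.pow_right j).eq, mul_assoc, ← pow_succ']
      exact e ▸ this
  have hpow : ∀ (t : HeisGen) (n : ℕ) (x : Heis p), x ∈ S →
      (PresentedGroup.of t : Heis p) ^ n * x ∈ S := by
    intro t n
    induction n with
    | zero => simp
    | succ n ih =>
      intro x hx
      rw [pow_succ', mul_assoc]
      exact hgen t _ (ih x hx)
  have hinv : ∀ t : HeisGen, (PresentedGroup.of t : Heis p)⁻¹ = PresentedGroup.of t ^ (p - 1) := by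
    intro t
    have : (PresentedGroup.of t : Heis p) ^ p = 1 := by
      cases t
      · exact Heis.a_pow p
      · exact Heis.b_pow p
      · exact Heis.c_pow p
    rw [inv_eq_iff_mul_eq_one, ← pow_succ', Nat.sub_add_cancel hp, this]
  have huniv : ∀ x : Heis p, x ∈ S := by
    intro x
    have hx : x ∈ Subgroup.closure (Set.range (PresentedGroup.of (rels := heisRels p))) := by
      rw [PresentedGroup.closure_range_of]; trivial
    induction hx using Subgroup.closure_induction_left with
    | one => simpa using hmem 0 0 0
    | mul_left x hx y _ ih =>
      obtain ⟨t, rfl⟩ := hx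
      exact hgen t y ih
    | inv_mul_cancel x hx y _ ih =>
      obtain ⟨t, rfl⟩ := hx
      rw [hinv]
      exact hpow t _ y ih
  exact Set.finite_univ_iff.1 (hS.subset fun x _ => huniv x)

/-! ### The Chevalley module `J_{G/H}`

The constructions are made over any commutative ring `k`; the Chevalley module is the case
`k = ℤ`. -/

variable (k : Type) [CommRing k] {G : Type} [Group G] (H : Subgroup G)

/-- The permutation representation `k[G/H]`. -/
abbrev permRep : Rep.{0} k G := Rep.ofMulAction k G (G ⧸ H)

/-- The augmentation map `ε : k[G/H] → k`, the sum of the coefficients. -/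
def augmentation : k[G ⧸ H] →ₗ[k] k :=
  Finsupp.linearCombination k (fun _ : G ⧸ H => (1 : k)) ∘ₗ
    (MonoidAlgebra.coeffLinearEquiv k).toLinearMap

theorem augmentation_single (q : G ⧸ H) (n : k) :
    augmentation k H (MonoidAlgebra.single q n) = n := by
  simp [augmentation]

theorem augmentation_smul (g : G) (x : k[G ⧸ H]) :
    augmentation k H (Representation.ofMulAction k G (G ⧸ H) g x) = augmentation k H x := by
  have : augmentation k H ∘ₗ Representation.ofMulAction k G (G ⧸ H) g = augmentation k H := by
    ext q
    simp [augmentation_single]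
  exact LinearMap.congr_fun this x

/-- The augmentation module `I_{G/H} = Ker ε`, as a representation of `G`. -/
def augRep : Representation k G (LinearMap.ker (augmentation k H)) :=
  (Representation.ofMulAction k G (G ⧸ H)).subrepresentation _ fun g x hx => by
    simpa [augmentation_smul] using hx

/-- The dual `J_{G/H} = Hom_k(I_{G/H}, k)`, with `(g f)(x) = f(g⁻¹ x)`. For `k = ℤ` this is the
Chevalley module. -/
abbrev chevalley : Rep.{0} k G := Rep.of (augRep k H).dual

/-- The coefficient pairing `⟨x, y⟩ = ∑_q x_q y_q` on `k[G/H]`. -/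
def pairing : k[G ⧸ H] →ₗ[k] k[G ⧸ H] →ₗ[k] k :=
  Finsupp.linearCombination k (fun q : G ⧸ H =>
    Finsupp.lapply q ∘ₗ (MonoidAlgebra.coeffLinearEquiv k).toLinearMap) ∘ₗ
    (MonoidAlgebra.coeffLinearEquiv k).toLinearMap

theorem pairing_single (q : G ⧸ H) (n : k) (y : k[G ⧸ H]) :
    pairing k H (MonoidAlgebra.single q n) y = n * y.coeff q := by
  simp [pairing]

theorem pairing_apply_single (x : k[G ⧸ H]) (q : G ⧸ H) :
    pairing k H x (MonoidAlgebra.single q 1) = x.coeff q := by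
  classical
  have : (pairing k H).flip (MonoidAlgebra.single q 1) =
      Finsupp.lapply q ∘ₗ (MonoidAlgebra.coeffLinearEquiv k).toLinearMap := by
    ext r
    simp [pairing_single, Finsupp.single_apply, eq_comm]
  exact LinearMap.congr_fun this x

theorem pairing_smul (g : G) (x y : k[G ⧸ H]) :
    pairing k H (Representation.ofMulAction k G (G ⧸ H) g x) y =
      pairing k H x (Representation.ofMulAction k G (G ⧸ H) g⁻¹ y) := by
  classical
  have : (pairing k H) ∘ₗ Representation.ofMulAction k G (G ⧸ H) g =
      (pairing k H).compl₂ (Representation.ofMulAction k G (G ⧸ H) g⁻¹) := by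
    ext q r
    simp [pairing_single, Finsupp.single_apply, inv_smul_eq_iff]
  exact LinearMap.congr_fun (LinearMap.congr_fun this x) y

/-- The map `k[G/H] → J_{G/H}` dual to the inclusion `I_{G/H} ⊆ k[G/H]`: it sends `x` to the
restriction of `⟨x, ·⟩` to `I_{G/H}`. -/
def toChevalley : permRep k H ⟶ chevalley k H :=
  Rep.ofHom
    { toLinearMap := (pairing k H).compl₂ (LinearMap.ker (augmentation k H)).subtype
      isIntertwining' := fun g => by
        refine LinearMap.ext fun x => LinearMap.ext fun y => ?_
        exact pairing_smul k H g x y }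

variable [Finite (G ⧸ H)]

/-- The sum of all cosets, in `k[G/H]`. -/
def cosetSum : k[G ⧸ H] :=
  letI := Fintype.ofFinite (G ⧸ H)
  ∑ q : G ⧸ H, MonoidAlgebra.single q (1 : k)

theorem coeff_cosetSum (q : G ⧸ H) : (cosetSum k H).coeff q = 1 := by
  classical
  simp [cosetSum, Finsupp.single_apply]

theorem smul_cosetSum (g : G) :
    Representation.ofMulAction k G (G ⧸ H) g (cosetSum k H) = cosetSum k H := by
  let _ := Fintype.ofFinite (G ⧸ H)
  simp only [cosetSum, map_sum, Representation.ofMulAction_single]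
  exact Fintype.sum_equiv (MulAction.toPerm g) _ _ fun _ => rfl

/-- The map `k → k[G/H]`, `n ↦ n ∑_q q`. -/
def fromTrivial : Rep.trivial k G k ⟶ permRep k H :=
  Rep.ofHom
    { toLinearMap := LinearMap.toSpanSingleton k _ (cosetSum k H)
      isIntertwining' := fun g => by
        refine LinearMap.ext fun n => ?_
        simp [smul_cosetSum] }

theorem pairing_cosetSum (y : k[G ⧸ H]) : pairing k H (cosetSum k H) y = augmentation k H y := by
  have : pairing k H (cosetSum k H) = augmentation k H := by
    ext q
    simp [pairing_apply_single, coeff_cosetSum, augmentation_single]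
  rw [this]

/-- The sequence `0 → k → k[G/H] → J_{G/H} → 0` of representations of `G`. -/
def chevalleySeq : ShortComplex (Rep.{0} k G) where
  X₁ := Rep.trivial k G k
  X₂ := permRep k H
  X₃ := chevalley k H
  f := fromTrivial k H
  g := toChevalley k H
  zero := by
    refine Rep.hom_ext (Representation.IntertwiningMap.ext (LinearMap.ext fun n => ?_))
    change k at n
    refine LinearMap.ext fun y => ?_
    change pairing k H (n • cosetSum k H) y = 0
    rw [map_smul, LinearMap.smul_apply, pairing_cosetSum, y.2, smul_zero]

theorem chevalleySeq_shortExact : (chevalleySeq k H).ShortExact where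
  exact := by
    rw [← ShortComplex.exact_map_iff_of_faithful _ (forget₂ (Rep.{0} k G) (ModuleCat k)),
      ShortComplex.moduleCat_exact_iff]
    intro x hx
    change k[G ⧸ H] at x
    have hx' : ∀ y : LinearMap.ker (augmentation k H), pairing k H x y = 0 := fun y =>
      LinearMap.congr_fun (f := (pairing k H).compl₂ (LinearMap.ker (augmentation k H)).subtype x)
        hx y
    let q₀ : G ⧸ H := ((1 : G) : G ⧸ H)
    refine ⟨(x.coeff q₀ : k), ?_⟩
    change x.coeff q₀ • cosetSum k H = x
    ext q
    have h := hx' ⟨MonoidAlgebra.single q 1 - MonoidAlgebra.single q₀ 1, by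
      simp [augmentation_single]⟩
    simp only [map_sub, pairing_apply_single, sub_eq_zero] at h
    simp [coeff_cosetSum, h]
  mono_f := by
    rw [Rep.mono_iff_injective]
    intro m n hmn
    change k at m n
    have h : m • cosetSum k H = n • cosetSum k H := hmn
    have h1 := congrArg (fun z : k[G ⧸ H] => z.coeff ((1 : G) : G ⧸ H)) h
    simp only [MonoidAlgebra.coeff_smul, Finsupp.smul_apply, coeff_cosetSum, smul_eq_mul,
      mul_one] at h1
    exact h1
  epi_g := by
    classical
    let _ := Fintype.ofFinite (G ⧸ H)
    rw [Rep.epi_iff_surjective]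
    intro f
    change Module.Dual k (LinearMap.ker (augmentation k H)) at f
    let q₀ : G ⧸ H := ((1 : G) : G ⧸ H)
    let pr : k[G ⧸ H] →ₗ[k] LinearMap.ker (augmentation k H) :=
      LinearMap.codRestrict _ (LinearMap.id -
        (augmentation k H).smulRight (MonoidAlgebra.single q₀ (1 : k))) fun y => by
          simp [augmentation_single]
    let x : k[G ⧸ H] := ∑ q : G ⧸ H, MonoidAlgebra.single q (f (pr (MonoidAlgebra.single q 1)))
    refine ⟨x, LinearMap.ext fun y => ?_⟩
    have hx : pairing k H x = f ∘ₗ pr := by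
      ext q
      simp [pairing_apply_single, x, Finsupp.single_apply]
    have hy : pr y = y := Subtype.ext (by simp [pr])
    change pairing k H x y = f y
    rw [hx, LinearMap.comp_apply, hy]

/-- The connecting homomorphism `δ : H²(G, J_{G/H}) → H³(G, k)` of the sequence
`0 → k → k[G/H] → J_{G/H} → 0`. -/
def connecting :
    groupCohomology (chevalley k H) 2 ⟶ groupCohomology (Rep.trivial k G k) 3 :=
  groupCohomology.δ (chevalleySeq_shortExact k H) 2 3 rfl

end

/-! ### The group `Ш²_ω` and the Schur multiplier -/

noncomputable section

variable {k : Type} [CommRing k] {G : Type} [Group G]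

/-- The restriction map `Hⁿ(G, A) → Hⁿ(C, A)` to a subgroup `C` of `G`. -/
abbrev restriction (A : Rep.{0} k G) (C : Subgroup G) (n : ℕ) :
    groupCohomology A n ⟶ groupCohomology (Rep.res C.subtype A) n :=
  groupCohomology.map C.subtype (𝟙 (Rep.res C.subtype A)) n

/-- `Ш²_ω(G, A)`: the classes in `H²(G, A)` that restrict to zero on every cyclic subgroup. -/
def shaOmega (A : Rep.{0} k G) : Submodule k (groupCohomology A 2) :=
  ⨅ C : {C : Subgroup G // IsCyclic C}, LinearMap.ker (restriction A C.1 2).hom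

/-- The Schur multiplier `M(G) = H²(G, ℂˣ)`, for the trivial action of `G` on `ℂˣ`. -/
abbrev schurMultiplier (G : Type) [Group G] : ModuleCat ℤ :=
  groupCohomology (Rep.trivial ℤ G (Additive ℂˣ)) 2

end

end HeisenbergHNP

/-! Since $L$ is the normal closure of $K$, the core of $H$ in $G$ is trivial. As $H\cap Z(G)$ is
normal, it vanishes, so commutators of elements of $H$, which lie in $H\cap Z(G)$, are trivial.
Hence $H$ embeds in $G/Z(G)=\mathbb F_p^2$ with image isotropic for the commutator form. So $H$ is
trivial or generated by some $h$ of order $p$, and a linear form on $G/Z(G)$ with value $1$ at $h$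
makes $H$ a retract of $G$ (`Heis.exists_generator`, `Heis.exists_retraction`).

For $\delta$, Shapiro's lemma gives $H^3(G,\mathbb Z[G/H])=H^3(H,\mathbb Z)=0$ because $H$ is
cyclic, so $\delta$ is onto. It is injective once the restriction $H^2(G,\mathbb Z)\to H^2(H,\mathbb
Z)$ is onto. Through the exponential sequence this says that characters of $H$ extend to $G$, and
the retraction extends them (`isIso_connecting`, for $H=1$ as well). When $H=1$, $\mathbb Z[G]$ is
free over each cyclic $C$, so $H^2(C,J_G)$ embeds in $H^3(C,\mathbb Z)=0$ (`shaOmega_bot`).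

The exponential sequence also gives $H^3(G,\mathbb Z)\simeq M(G)$. To compute $M(G)$, view a class
as a central extension by $\mathbb C^\times$ and record the commutators of lifts of $c$ with lifts
of $a$ and of $b$. If both vanish, the presentation of $G$ yields a splitting; both are $p$-torsion;
explicit cocycles, which need $1/2$ modulo $p$, realise every pair of $p$-th roots of unity. -/

namespace HeisenbergHNP

noncomputable section

open Limits Rep

/-! ### Vanishing of cohomology -/

section Vanishing

variable {k : Type} [CommRing k] {G : Type} [Group G]

/-- The module of all functions `G → A`, coinduced from the trivial subgroup. -/
abbrev coindBot (A : Rep.{0} k G) : Rep.{0} k G :=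
  Rep.coind (⊥ : Subgroup G).subtype (Rep.trivial k (⊥ : Subgroup G) A.V)

/-- Shapiro's lemma reduces this to the cohomology of the trivial group. -/
theorem isZero_groupCohomology_coindBot (A : Rep.{0} k G) (n : ℕ) :
    IsZero (groupCohomology (coindBot A) (n + 1)) :=
  (isZero_groupCohomology_succ_of_subsingleton _ n).of_iso (groupCohomology.coindIso _ (n + 1))

/-- The embedding of a representation into the functions on the group. -/
def toCoindBot (A : Rep.{0} k G) : A ⟶ coindBot A :=
  Rep.ofHom
    { toFun := fun x => ⟨fun g => A.ρ g x, by
        rintro ⟨g, hg⟩ h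
        obtain rfl := Subgroup.mem_bot.1 hg
        simp⟩
      map_add' := fun x y => Subtype.ext <| funext fun g => by simp
      map_smul' := fun r x => Subtype.ext <| funext fun g => by simp
      isIntertwining' := fun g => LinearMap.ext fun x => Subtype.ext <| funext fun h => by
        change A.ρ h (A.ρ g x) = A.ρ (h * g) x
        simp }

variable [Fintype G]

/-- The map `f ↦ ∑ g, g⁻¹ u (f g)` from the functions on a finite group. -/
def ofCoindBot (A : Rep.{0} k G) (u : A.V →ₗ[k] A.V) : coindBot A ⟶ A :=
  Rep.ofHom
    { toFun := fun f => ∑ g : G, A.ρ g⁻¹ (u (f.1 g))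
      map_add' := fun x y => by simp [Finset.sum_add_distrib]
      map_smul' := fun r x => by simp [Finset.smul_sum]
      isIntertwining' := fun g => LinearMap.ext fun f => by
        change ∑ h : G, A.ρ h⁻¹ (u (f.1 (h * g))) = A.ρ g (∑ h : G, A.ρ h⁻¹ (u (f.1 h)))
        rw [map_sum]
        refine Fintype.sum_equiv (Equiv.mulRight g) _ _ fun h => ?_
        change _ = A.ρ g (A.ρ (h * g)⁻¹ (u (f.1 (h * g))))
        simp [mul_inv_rev] }

/-- The hypothesis makes `A` a direct summand of a coinduced module, so the identity of its
cohomology factors through zero. It is applied with `u` a projection onto a transversal, and with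
`u` division by the group order. -/
theorem isZero_groupCohomology_of_sum_conj (A : Rep.{0} k G) (u : A.V →ₗ[k] A.V)
    (hu : ∀ x : A.V, ∑ g : G, A.ρ g⁻¹ (u (A.ρ g x)) = x) (n : ℕ) :
    IsZero (groupCohomology A (n + 1)) := by
  have h : toCoindBot A ≫ ofCoindBot A u = 𝟙 A := by
    ext x
    exact hu x
  let F := groupCohomology.functor k G (n + 1)
  rw [IsZero.iff_id_eq_zero]
  change 𝟙 (F.obj A) = 0
  have hz : F.map (toCoindBot A) = 0 := (isZero_groupCohomology_coindBot A n).eq_zero_of_tgt _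
  rw [← F.map_id, ← h, F.map_comp, hz, zero_comp]

end Vanishing

/-! ### Odd cohomology of cyclic groups with integer coefficients -/

section Cyclic

variable {G : Type} [Group G] [Finite G] [IsCyclic G]

/-- Odd cohomology is the kernel of the norm modulo the image of $g-1$; on trivial $\mathbb Z$ the
norm is multiplication by the group order, which is injective. -/
theorem isZero_groupCohomology_trivial_int_of_isCyclic {n : ℕ} (hn : Odd n) :
    IsZero (groupCohomology (Rep.trivial ℤ G ℤ) n) := by
  let _ : CommGroup G := IsCyclic.commGroup
  let _ := Fintype.ofFinite G
  obtain ⟨g, hg⟩ := IsCyclic.exists_generator (α := G)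
  refine IsZero.of_iso ?_ (Rep.FiniteCyclicGroup.groupCohomologyIsoOdd (Rep.trivial ℤ G ℤ) g hg n hn)
  rw [← ShortComplex.exact_iff_isZero_homology, ShortComplex.moduleCat_exact_iff]
  intro x hx
  change ℤ at x
  refine ⟨0, ?_⟩
  have h : Representation.norm (Representation.trivial ℤ G ℤ) x = 0 := hx
  have h' : (Fintype.card G : ℤ) * x = 0 := by simpa [Representation.norm] using h
  have : x = 0 := by simpa [Fintype.card_ne_zero] using h'
  rw [this, map_zero]

end Cyclic

/-! ### Coefficients on which the group order is invertible -/

section Divisible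

variable {k : Type} [CommRing k] {G : Type} [Group G] [Finite G]

theorem isZero_groupCohomology_of_nsmul_right_inverse (A : Rep.{0} k G) (d : A ⟶ A)
    (hd : ∀ x : A.V, Nat.card G • d.hom x = x) (n : ℕ) : IsZero (groupCohomology A (n + 1)) := by
  let _ := Fintype.ofFinite G
  refine isZero_groupCohomology_of_sum_conj A d.hom.toLinearMap (fun x => ?_) n
  have h : ∀ g : G, A.ρ g⁻¹ (d.hom (A.ρ g x)) = d.hom x := fun g => by
    rw [Rep.hom_comm_apply]
    simp
  calc _ = ∑ g : G, A.ρ g⁻¹ (d.hom (A.ρ g x)) := rfl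
    _ = x := by simp only [h, Finset.sum_const, Finset.card_univ, ← Nat.card_eq_fintype_card, hd]

end Divisible

/-! ### The exponential sequence and the Schur multiplier -/

section Exponential

/-- The exponential sequence `0 → ℤ → ℂ → ℂˣ → 0`. -/
def expSeq : ShortComplex (ModuleCat.{0} ℤ) where
  X₁ := ModuleCat.of ℤ ℤ
  X₂ := ModuleCat.of ℤ ℂ
  X₃ := ModuleCat.of ℤ (Additive ℂˣ)
  f := ModuleCat.ofHom (Int.castAddHom ℂ).toIntLinearMap
  g := ModuleCat.ofHom (AddMonoidHom.toIntLinearMap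
    { toFun := fun z => Additive.ofMul (Units.mk0 (Complex.exp (2 * Real.pi * Complex.I * z))
        (Complex.exp_ne_zero _))
      map_zero' := by
        rw [← ofMul_one]
        exact congrArg _ (Units.ext (by simp))
      map_add' := fun z w => by
        rw [← ofMul_mul]
        exact congrArg _ (Units.ext (by simp [mul_add, Complex.exp_add])) })
  zero := by
    refine ModuleCat.hom_ext (LinearMap.ext fun n => ?_)
    change ℤ at n
    refine congrArg Additive.ofMul (Units.ext ?_)
    refine Complex.exp_eq_one_iff.2 ⟨n, ?_⟩
    rw [mul_comm]
    rfl

theorem expSeq_f_injective : Function.Injective expSeq.f.hom := fun _ _ h => Int.cast_injective h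

theorem expSeq_g_surjective : Function.Surjective expSeq.g.hom := by
  intro y
  change Additive ℂˣ at y
  refine ⟨(Complex.log (y.toMul : ℂ) / (2 * Real.pi * Complex.I) : ℂ), ?_⟩
  refine congrArg Additive.ofMul (Units.ext ?_)
  change Complex.exp (2 * Real.pi * Complex.I * _) = (y.toMul : ℂ)
  rw [mul_div_cancel₀ _ Complex.two_pi_I_ne_zero, Complex.exp_log (Units.ne_zero _)]

theorem expSeq_exact (z : expSeq.X₂) (hz : expSeq.g.hom z = 0) : ∃ n, expSeq.f.hom n = z := by
  change ℂ at z
  have h : Complex.exp (2 * Real.pi * Complex.I * z) = 1 :=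
    congrArg (fun y : Additive ℂˣ => ((y.toMul : ℂˣ) : ℂ)) hz
  obtain ⟨n, hn⟩ := Complex.exp_eq_one_iff.1 h
  refine ⟨n, ?_⟩
  change (n : ℂ) = z
  rw [mul_comm (n : ℂ)] at hn
  exact (mul_left_cancel₀ Complex.two_pi_I_ne_zero hn).symm

/-- Multiplication by a complex number, as a map of abelian groups. -/
def complexMul (w : ℂ) : expSeq.X₂ ⟶ expSeq.X₂ :=
  ModuleCat.ofHom (AddMonoidHom.mulLeft w).toIntLinearMap

theorem nsmul_complexMul {n : ℕ} (hn : n ≠ 0) (z : expSeq.X₂) :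
    n • (complexMul (n : ℂ)⁻¹).hom z = z := by
  change ℂ at z
  change n • ((n : ℂ)⁻¹ * z) = z
  rw [nsmul_eq_mul, mul_inv_cancel_left₀ (Nat.cast_ne_zero.2 hn)]

variable {k : Type} [CommRing k] {G : Type} [Group G]

instance : (Rep.trivialFunctor.{0} k G).PreservesZeroMorphisms := ⟨fun _ _ => rfl⟩

theorem shortExact_of_injective_of_surjective {S : ShortComplex (Rep.{0} k G)}
    (hf : Function.Injective S.f.hom) (hg : Function.Surjective S.g.hom)
    (h : ∀ x : S.X₂.V, S.g.hom x = 0 → ∃ y : S.X₁.V, S.f.hom y = x) : S.ShortExact where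
  exact := by
    rw [← ShortComplex.exact_map_iff_of_faithful _ (forget₂ (Rep.{0} k G) (ModuleCat k)),
      ShortComplex.moduleCat_exact_iff]
    exact h
  mono_f := (Rep.mono_iff_injective _).2 hf
  epi_g := (Rep.epi_iff_surjective _).2 hg

/-- The exponential sequence with trivial action. -/
abbrev expTrivial (G : Type) [Group G] : ShortComplex (Rep.{0} ℤ G) :=
  expSeq.map (Rep.trivialFunctor ℤ G)

theorem expTrivial_shortExact : (expTrivial G).ShortExact :=
  shortExact_of_injective_of_surjective expSeq_f_injective expSeq_g_surjective expSeq_exact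

theorem isZero_groupCohomology_expTrivial [Finite G] (n : ℕ) :
    IsZero (groupCohomology (expTrivial G).X₂ (n + 1)) :=
  isZero_groupCohomology_of_nsmul_right_inverse _
    ((Rep.trivialFunctor ℤ G).map (complexMul (Nat.card G : ℂ)⁻¹))
    (nsmul_complexMul Nat.card_pos.ne') n

/-- `H³(G, ℤ) ≃ H²(G, ℂˣ)` for a finite group. -/
theorem nonempty_addEquiv_schurMultiplier [Finite G] :
    Nonempty (groupCohomology (Rep.trivial ℤ G ℤ) 3 ≃+ schurMultiplier G) := by
  -- $H^2$ and $H^3$ with coefficients in $\mathbb C$ both vanish, by unique divisibility.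
  have := groupCohomology.isIso_δ_of_isZero (expTrivial_shortExact (G := G)) 2
    (isZero_groupCohomology_expTrivial 1) (isZero_groupCohomology_expTrivial 2)
  let e := (asIso (groupCohomology.δ (expTrivial_shortExact (G := G)) 2 3 rfl)).toLinearEquiv
  exact ⟨e.symm.toAddEquiv⟩

end Exponential

/-! ### Restriction to a retract, and the connecting homomorphism -/

section Coinduced

variable {k : Type} [CommRing k] {G : Type} [Group G] (H : Subgroup G)

variable (k) in
/-- The functor sending a module `M` to the module of functions `H\G → M`. -/
abbrev coindTrivial : ModuleCat.{0} k ⥤ Rep.{0} k G :=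
  Rep.trivialFunctor k H ⋙ Rep.coindFunctor k H.subtype

instance : (coindTrivial k H).PreservesZeroMorphisms := ⟨fun _ _ => rfl⟩

variable (k) in
/-- The embedding of the constant functions. -/
def constTrivial : Rep.trivialFunctor k G ⟶ coindTrivial k H where
  app _ := Rep.ofHom
    { toFun := fun x => ⟨fun _ => x, fun _ _ => rfl⟩
      map_add' := fun _ _ => rfl
      map_smul' := fun _ _ => rfl
      isIntertwining' := fun _ => rfl }
  naturality _ _ _ := rfl

theorem expCoind_shortExact : (expSeq.map (coindTrivial ℤ H)).ShortExact := by
  refine shortExact_of_injective_of_surjective ?_ ?_ ?_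
  · intro x y hxy
    exact Subtype.ext <| funext fun g => expSeq_f_injective (congrFun (congrArg Subtype.val hxy) g)
  · intro y
    -- Applying one set-theoretic section pointwise keeps the lift invariant under `H`.
    refine ⟨⟨fun g => Function.surjInv expSeq_g_surjective (y.1 g), fun h g => ?_⟩, ?_⟩
    · exact congrArg _ (y.2 h g)
    · exact Subtype.ext <| funext fun g => Function.surjInv_eq expSeq_g_surjective (y.1 g)
  · intro x hx
    choose n hn using fun g => expSeq_exact (x.1 g) (congrFun (congrArg Subtype.val hx) g)
    refine ⟨⟨n, fun h g => ?_⟩, Subtype.ext <| funext hn⟩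
    refine expSeq_f_injective ?_
    rw [hn]
    exact (x.2 h g).trans (hn g).symm

theorem isZero_groupCohomology_expCoind [Finite G] (n : ℕ) :
    IsZero (groupCohomology (expSeq.map (coindTrivial ℤ H)).X₂ (n + 1)) :=
  isZero_groupCohomology_of_nsmul_right_inverse _
    ((coindTrivial ℤ H).map (complexMul (Nat.card G : ℂ)⁻¹))
    (fun x => Subtype.ext <| funext fun g => nsmul_complexMul Nat.card_pos.ne' (x.1 g)) n

variable {H}

/-- Under Shapiro's isomorphism this map is the restriction $\mathrm{Hom}(G,M)\to\mathrm{Hom}(H,M)$,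
and composing with `r` extends homomorphisms from `H` to `G`. -/
theorem map_constTrivial_one_surjective (r : G →* H) (hr : ∀ h : H, r h = h)
    (M : ModuleCat.{0} k) : Function.Surjective
      ((groupCohomology.functor k G 1).map ((constTrivial k H).app M)).hom := by
  intro x
  induction x using groupCohomology.H1_induction_on with | h f =>
  have hf := (groupCohomology.mem_cocycles₁_iff _).1 f.2
  let F : G → G → M := fun g => (f g).1
  have hf' : ∀ g g' y : G, F (g * g') y = F g' (y * g) + F g y := fun g g' y =>
    congrFun (congrArg Subtype.val (hf g g')) y
  have hH : ∀ (g : G) (h : H) (y : G), F g (h * y) = F g y := fun g h y => (f g).2 h y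
  -- Shapiro's recipe: restrict the cocycle to `H` and evaluate at $1$.
  let χ : Additive H →+ M := AddMonoidHom.mk' (fun h => F h.toMul 1) fun h h' => by
    have := hf' h.toMul h'.toMul 1
    have e := hH (h'.toMul : G) h.toMul 1
    rw [mul_one] at e
    rw [one_mul, e, add_comm] at this
    exact this
  have hχ : ∀ h : H, χ (Additive.ofMul h) = F h 1 := fun _ => rfl
  let c : groupCohomology.cocycles₁ ((Rep.trivialFunctor k G).obj M) :=
    ⟨fun g => χ (Additive.ofMul (r g)), by
      rw [groupCohomology.mem_cocycles₁_iff]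
      intro g g'
      rw [map_mul, ofMul_mul, map_add, add_comm]
      rfl⟩
  refine ⟨groupCohomology.H1π _ c, ?_⟩
  have := groupCohomology.H1π_comp_map_apply (A := (Rep.trivialFunctor k G).obj M) (MonoidHom.id G)
    ((constTrivial k H).app M) c
  refine this.trans ?_
  rw [groupCohomology.H1π_eq_iff]
  -- The difference $\chi\circ r-f$ is the coboundary of this function; that `r` fixes `H` is what
  -- makes it `H`-invariant.
  let u : (coindTrivial k H).obj M := ⟨fun y => χ (Additive.ofMul (r y)) - F y 1, fun h y => by
    change χ (Additive.ofMul (r (h * y))) - F (h * y) 1 = _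
    have e := hH y h 1
    rw [mul_one] at e
    rw [map_mul, hr, ofMul_mul, map_add, hf', one_mul, hχ, e]
    change (_ : M) = (_ : M) - (_ : M)
    abel⟩
  refine ⟨u, ?_⟩
  funext g
  refine Subtype.ext <| funext fun y => ?_
  change χ (Additive.ofMul (r (y * g))) - F (y * g) 1 -
    (χ (Additive.ofMul (r y)) - F y 1) = χ (Additive.ofMul (r g)) - F g y
  rw [map_mul, ofMul_mul, map_add, hf', one_mul]
  abel

/-- Dimension shifting: $\delta$ from degree one with coinduced $\mathbb C^\times$ coefficients is
onto, since the coinduced module of $\mathbb C$ has no $H^2$, and naturality of $\delta$ transports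
the degree one statement. -/
theorem map_constTrivial_two_surjective [Finite G] (r : G →* H) (hr : ∀ h : H, r h = h) :
    Function.Surjective
      ((groupCohomology.functor ℤ G 2).map ((constTrivial ℤ H).app (ModuleCat.of ℤ ℤ))).hom := by
  have hepi := groupCohomology.epi_δ_of_isZero (expCoind_shortExact H) 1
    (isZero_groupCohomology_expCoind H 1)
  have hsurj := (ModuleCat.epi_iff_surjective _).1 hepi
  have nat := groupCohomology.δ_naturality (expTrivial_shortExact (G := G)) (expCoind_shortExact H)
    (expSeq.mapNatTrans (constTrivial ℤ H)) 1 2 rfl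
  intro x
  obtain ⟨y, rfl⟩ := hsurj x
  obtain ⟨z, rfl⟩ := map_constTrivial_one_surjective r hr expSeq.X₃ y
  exact ⟨groupCohomology.δ (expTrivial_shortExact (G := G)) 1 2 rfl z,
    congrArg (fun φ => φ.hom z) nat⟩

/-- The permutation module `k[G/H]` as the module of functions `H\G → k`. -/
def permToCoind (k : Type) [CommRing k] {G : Type} [Group G] (H : Subgroup G) :
    permRep k H ⟶ (coindTrivial k H).obj (ModuleCat.of k k) :=
  Rep.ofHom
    -- The inverse turns functions on left cosets $gH$ into functions on $G$ invariant under left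
    -- translation by $H$.
    { toFun := fun x => ⟨fun g => x.coeff ((g⁻¹ : G) : G ⧸ H), fun h g => by
        refine congrArg x.coeff (QuotientGroup.eq.2 ?_)
        change ((h : G) * g)⁻¹⁻¹ * g⁻¹ ∈ H
        simp⟩
      map_add' := fun x y => Subtype.ext <| funext fun g => by simp
      map_smul' := fun r x => Subtype.ext <| funext fun g => by simp
      isIntertwining' := fun g => by
        ext q : 2
        refine Subtype.ext <| funext fun h => ?_
        classical
        change (Representation.ofMulAction k G (G ⧸ H) g (MonoidAlgebra.single q 1)).coeff
            ((h⁻¹ : G) : G ⧸ H) =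
          (MonoidAlgebra.single q (1 : k)).coeff (((h * g)⁻¹ : G) : G ⧸ H)
        have e : (((h * g)⁻¹ : G) : G ⧸ H) = g⁻¹ • ((h⁻¹ : G) : G ⧸ H) := by
          rw [mul_inv_rev]; rfl
        rw [e]
        simp only [Representation.ofMulAction_single, MonoidAlgebra.coeff_single, Finsupp.single_apply,
          eq_inv_smul_iff] }

theorem permToCoind_bijective [Finite G] : Function.Bijective (permToCoind k H).hom := by
  constructor
  · intro x y hxy
    refine MonoidAlgebra.coeff_injective (Finsupp.ext fun q => ?_)
    obtain ⟨g, rfl⟩ := QuotientGroup.mk_surjective q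
    have := congrFun (congrArg Subtype.val hxy) g⁻¹
    change x.coeff ((g⁻¹⁻¹ : G) : G ⧸ H) = y.coeff ((g⁻¹⁻¹ : G) : G ⧸ H) at this
    rwa [inv_inv] at this
  · intro f
    have hf : ∀ (h : H) (g : G), f.1 (h * g) = f.1 g := f.2
    let φ : G ⧸ H → k := Quotient.lift (fun g : G => (f.1 g⁻¹ : k)) fun a b hab => by
      have := hf ⟨_, H.inv_mem (QuotientGroup.leftRel_apply.1 hab)⟩ a⁻¹
      simpa using this.symm
    refine ⟨MonoidAlgebra.ofCoeff (Finsupp.equivFunOnFinite.symm φ), ?_⟩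
    refine Subtype.ext <| funext fun g => ?_
    change φ ((g⁻¹ : G) : G ⧸ H) = f.1 g
    change f.1 g⁻¹⁻¹ = f.1 g
    rw [inv_inv]

instance isIso_permToCoind [Finite G] : IsIso (permToCoind k H) := by
  rw [← isIso_iff_of_reflects_iso _ (forget (Rep.{0} k G)), isIso_iff_bijective]
  exact permToCoind_bijective

theorem fromTrivial_comp_permToCoind [Finite G] :
    fromTrivial k H ≫ permToCoind k H = (constTrivial k H).app (ModuleCat.of k k) := by
  ext : 3
  refine Subtype.ext <| funext fun g => ?_
  change ((1 : k) • cosetSum k H).coeff ((g⁻¹ : G) : G ⧸ H) = 1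
  simp [coeff_cosetSum]

/-- The next term of the long exact sequence is $H^3(H,\mathbb Z)=0$, so $\delta$ is epi. The
preceding map out of $H^2(G,\mathbb Z)$ is the restriction to the retract `H`, hence epi, so the map
into $H^2(G,J_{G/H})$ is zero and $\delta$ is mono. -/
theorem isIso_connecting [Finite G] [IsCyclic H] (r : G →* H) (hr : ∀ h : H, r h = h) :
    IsIso (connecting ℤ H) := by
  have hX₂ : IsZero (groupCohomology (permRep ℤ H) 3) :=
    ((isZero_groupCohomology_trivial_int_of_isCyclic (G := H) (n := 3) (by decide)).of_iso
      (groupCohomology.coindIso (Rep.trivial ℤ H ℤ) 3)).of_iso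
      ((groupCohomology.functor ℤ G 3).mapIso (asIso (permToCoind ℤ H)))
  have hepi : Epi (connecting ℤ H) :=
    groupCohomology.epi_δ_of_isZero (chevalleySeq_shortExact ℤ H) 2 hX₂
  let F := groupCohomology.functor ℤ G 2
  have hf : Epi (F.map (fromTrivial ℤ H)) := by
    have h : F.map (fromTrivial ℤ H) ≫ F.map (permToCoind ℤ H) =
        F.map ((constTrivial ℤ H).app (ModuleCat.of ℤ ℤ)) := by
      rw [← F.map_comp, fromTrivial_comp_permToCoind]
    have h2 : Epi (F.map ((constTrivial ℤ H).app (ModuleCat.of ℤ ℤ))) :=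
      (ModuleCat.epi_iff_surjective _).2 (map_constTrivial_two_surjective r hr)
    rw [← h] at h2
    have e : F.map (fromTrivial ℤ H) =
        (F.map (fromTrivial ℤ H) ≫ F.map (permToCoind ℤ H)) ≫ inv (F.map (permToCoind ℤ H)) := by
      simp
    rw [e]
    exact epi_comp _ _
  have hg : F.map (toChevalley ℤ H) = 0 := by
    rw [← cancel_epi (F.map (fromTrivial ℤ H)), ← F.map_comp, comp_zero]
    exact (congrArg F.map (chevalleySeq ℤ H).zero).trans (F.map_zero _ _)
  have hmono : Mono (connecting ℤ H) :=
    (groupCohomology.mapShortComplex₃_exact (chevalleySeq_shortExact ℤ H) rfl).mono_g hg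
  exact isIso_of_mono_of_epi _

end Coinduced

/-! ### Vanishing on cyclic subgroups when $H=1$ -/

section Sha

variable {G : Type} [Group G] [Finite G]

/-- The module is free over `C`, with basis a transversal `T` of $C\backslash G$. The projection `u`
onto the span of `T` has `C`-conjugates summing to the identity, as each $Cg$ meets `T` once. -/
theorem isZero_groupCohomology_res_permRep (k : Type) [CommRing k] (C : Subgroup G) (n : ℕ) :
    IsZero (groupCohomology (Rep.res C.subtype (permRep k (⊥ : Subgroup G))) (n + 1)) := by
  classical
  let _ := Fintype.ofFinite C
  obtain ⟨T, hT, -⟩ := C.exists_isComplement_right 1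
  let T' : Set (G ⧸ (⊥ : Subgroup G)) := QuotientGroup.mk '' T
  let u : k[G ⧸ (⊥ : Subgroup G)] →ₗ[k] k[G ⧸ (⊥ : Subgroup G)] :=
    Finsupp.linearCombination k (fun q => if q ∈ T' then MonoidAlgebra.single q (1 : k) else 0) ∘ₗ
      (MonoidAlgebra.coeffLinearEquiv k).toLinearMap
  have hu : ∀ q, u (MonoidAlgebra.single q 1) = if q ∈ T' then MonoidAlgebra.single q 1 else 0 :=
    fun q => by simp [u]
  refine isZero_groupCohomology_of_sum_conj _ u (fun x => ?_) n
  let ρ := Representation.ofMulAction k G (G ⧸ (⊥ : Subgroup G))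
  have key : ∑ c : C, ρ (c : G)⁻¹ ∘ₗ u ∘ₗ ρ c = LinearMap.id := by
    ext q : 2
    obtain ⟨g, rfl⟩ := QuotientGroup.mk_surjective q
    have hmem : ∀ c : C, ((c : G) • (g : G ⧸ (⊥ : Subgroup G)) ∈ T') ↔ (c : G) * g ∈ T := by
      intro c
      constructor
      · rintro ⟨t, ht, e⟩
        have : t⁻¹ * ((c : G) * g) = 1 := by simpa using QuotientGroup.eq.1 e
        rwa [← inv_mul_eq_one.1 this]
      · exact fun h => ⟨_, h, rfl⟩
    obtain ⟨c, hc, huniq⟩ : ∃! c : C, (c : G)⁻¹ * g ∈ T :=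
      Subgroup.isComplement_iff_existsUnique_inv_mul_mem.1 hT g
    have hterm : ∀ c : C, ρ (c : G)⁻¹ (u (ρ c (MonoidAlgebra.single (g : G ⧸ (⊥ : Subgroup G)) 1))) =
        if (c : G) * g ∈ T then MonoidAlgebra.single (g : G ⧸ (⊥ : Subgroup G)) 1 else 0 := by
      intro c
      simp only [ρ, Representation.ofMulAction_single, hu, hmem]
      split_ifs
      · rw [Representation.ofMulAction_single, inv_smul_smul]
      · rw [map_zero]
    change (∑ c : C, ρ (c : G)⁻¹ ∘ₗ u ∘ₗ ρ c) (MonoidAlgebra.single (g : G ⧸ (⊥ : Subgroup G)) 1) =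
      MonoidAlgebra.single (g : G ⧸ (⊥ : Subgroup G)) 1
    rw [LinearMap.sum_apply]
    simp only [LinearMap.comp_apply, hterm]
    refine (Finset.sum_eq_single c⁻¹ ?_ ?_).trans (if_pos ?_)
    · intro d _ hd
      rw [if_neg]
      intro h
      exact hd (inv_eq_iff_eq_inv.1 (huniq d⁻¹ (by simpa using h)))
    · simp
    · exact hc
  have hx := LinearMap.congr_fun key x
  rw [LinearMap.sum_apply] at hx
  exact hx

theorem shaOmega_bot : shaOmega (chevalley ℤ (⊥ : Subgroup G)) = ⊤ := by
  rw [shaOmega, iInf_eq_top]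
  rintro ⟨C, hC⟩
  rw [LinearMap.ker_eq_top]
  let S := (chevalleySeq ℤ (⊥ : Subgroup G)).map (Rep.resFunctor C.subtype)
  have hS : S.ShortExact := (chevalleySeq_shortExact ℤ (⊥ : Subgroup G)).map_of_exact _
  have h3 : IsZero (groupCohomology S.X₁ 3) :=
    isZero_groupCohomology_trivial_int_of_isCyclic (G := C) (n := 3) (by decide)
  have h2 : IsZero (groupCohomology S.X₂ 2) := isZero_groupCohomology_res_permRep ℤ C 1
  have := groupCohomology.mono_δ_of_isZero hS 2 h2
  have h : IsZero (groupCohomology S.X₃ 2) := h3.of_mono (groupCohomology.δ hS 2 3 rfl)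
  exact congrArg ModuleCat.Hom.hom (h.eq_zero_of_tgt (restriction _ C 2))

end Sha

end

end HeisenbergHNP

namespace HeisenbergHNP

/-! ### The structure of the Heisenberg group -/

/-- The upper triangular unipotent matrices of size three, with coordinates such that `(x, y, z)`
is `a ^ x * b ^ y * c ^ z`. -/
@[ext]
structure HeisModel (p : ℕ) where
  x : ZMod p
  y : ZMod p
  z : ZMod p

namespace HeisModel

variable {p : ℕ}

/-- The term $g_y h_x$ comes from $b^j a^i=a^i b^j c^{ji}$. -/
instance : Mul (HeisModel p) := ⟨fun g h => ⟨g.x + h.x, g.y + h.y, g.z + h.z + g.y * h.x⟩⟩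
instance : One (HeisModel p) := ⟨⟨0, 0, 0⟩⟩
instance : Inv (HeisModel p) := ⟨fun g => ⟨-g.x, -g.y, -g.z + g.y * g.x⟩⟩

@[simp] theorem mul_x (g h : HeisModel p) : (g * h).x = g.x + h.x := rfl
@[simp] theorem mul_y (g h : HeisModel p) : (g * h).y = g.y + h.y := rfl
@[simp] theorem mul_z (g h : HeisModel p) : (g * h).z = g.z + h.z + g.y * h.x := rfl
@[simp] theorem one_x : (1 : HeisModel p).x = 0 := rfl
@[simp] theorem one_y : (1 : HeisModel p).y = 0 := rfl
@[simp] theorem one_z : (1 : HeisModel p).z = 0 := rfl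
@[simp] theorem inv_x (g : HeisModel p) : g⁻¹.x = -g.x := rfl
@[simp] theorem inv_y (g : HeisModel p) : g⁻¹.y = -g.y := rfl
@[simp] theorem inv_z (g : HeisModel p) : g⁻¹.z = -g.z + g.y * g.x := rfl

instance : Group (HeisModel p) :=
  Group.ofLeftAxioms (fun g h k => by ext <;> simp <;> ring) (fun g => by ext <;> simp)
    (fun g => by ext <;> simp)

theorem pow_x (g : HeisModel p) (n : ℕ) : (g ^ n).x = n * g.x := by
  induction n with
  | zero => simp
  | succ n ih => rw [pow_succ, mul_x, ih]; push_cast; ring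

theorem pow_y (g : HeisModel p) (n : ℕ) : (g ^ n).y = n * g.y := by
  induction n with
  | zero => simp
  | succ n ih => rw [pow_succ, mul_y, ih]; push_cast; ring

/-- In general a term $\binom n2\,g_y g_x$ appears; the hypothesis removes it. -/
theorem pow_z (g : HeisModel p) (h : g.y * g.x = 0) (n : ℕ) : (g ^ n).z = n * g.z := by
  induction n with
  | zero => simp
  | succ n ih =>
    rw [pow_succ, mul_z, ih, pow_y, mul_assoc, h]; push_cast; ring

/-- The generators of the model. -/
def gen (p : ℕ) : HeisGen → HeisModel p
  | .a => ⟨1, 0, 0⟩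
  | .b => ⟨0, 1, 0⟩
  | .c => ⟨0, 0, 1⟩

theorem lift_gen_of_mem (r : FreeGroup HeisGen) (hr : r ∈ heisRels p) :
    FreeGroup.lift (gen p) r = 1 := by
  simp only [heisRels, Set.mem_insert_iff, Set.mem_singleton_iff] at hr
  rcases hr with rfl | rfl | rfl | rfl | rfl | rfl <;>
    simp only [map_mul, map_inv, map_pow, FreeGroup.lift_apply_of, gen] <;> ext <;>
    simp [pow_x, pow_y, pow_z]

end HeisModel

namespace Heis

variable {p : ℕ}

/-- The coordinates of an element of the Heisenberg group. -/
def toModel (p : ℕ) : Heis p →* HeisModel p :=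
  PresentedGroup.toGroup HeisModel.lift_gen_of_mem

@[simp] theorem toModel_a : toModel p (a p) = ⟨1, 0, 0⟩ := PresentedGroup.toGroup.of _
@[simp] theorem toModel_b : toModel p (b p) = ⟨0, 1, 0⟩ := PresentedGroup.toGroup.of _
@[simp] theorem toModel_c : toModel p (c p) = ⟨0, 0, 1⟩ := PresentedGroup.toGroup.of _

theorem b_pow_mul_a_pow (i j : ℕ) :
    b p ^ j * a p ^ i = a p ^ i * (b p ^ j * c p ^ (j * i)) := by
  have hcb : Commute (c p) (b p) := cb p
  induction j with
  | zero => simp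
  | succ j ih =>
    rw [pow_succ', mul_assoc, ih, ← mul_assoc, b_mul_a_pow, mul_assoc, mul_assoc, ← mul_assoc (c p ^ i),
      (hcb.pow_pow i j).eq, mul_assoc, ← pow_add, add_mul, one_mul, add_comm i]
    simp only [mul_assoc]

theorem pow_val_add {G : Type*} [Monoid G] [NeZero p] {x : G} (hx : x ^ p = 1) (i j : ZMod p) :
    x ^ (i + j).val = x ^ i.val * x ^ j.val := by
  rw [ZMod.val_add, ← pow_add]
  exact (pow_eq_pow_mod _ hx).symm

theorem pow_val_mul {G : Type*} [Monoid G] {x : G} (hx : x ^ p = 1) (i j : ZMod p) :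
    x ^ (i * j).val = x ^ (i.val * j.val) := by
  rw [ZMod.val_mul]
  exact (pow_eq_pow_mod _ hx).symm

/-- The element with given coordinates. -/
def ofModel (p : ℕ) [NeZero p] : HeisModel p →* Heis p :=
  MonoidHom.mk' (fun g => a p ^ g.x.val * (b p ^ g.y.val * c p ^ g.z.val)) fun g h => by
    have hca : Commute (c p) (a p) := ca p
    have hcb : Commute (c p) (b p) := cb p
    simp only [HeisModel.mul_x, HeisModel.mul_y, HeisModel.mul_z, pow_val_add (a_pow p),
      pow_val_add (b_pow p), pow_val_add (c_pow p), pow_val_mul (c_pow p)]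
    generalize g.x.val = i, g.y.val = j, g.z.val = l, h.x.val = i', h.y.val = j', h.z.val = l'
    calc _ = a p ^ i * (a p ^ i' * (b p ^ j * (b p ^ j' * (c p ^ (l + l' + j * i'))))) := by
          simp only [mul_assoc, pow_add]
      _ = a p ^ i * ((a p ^ i' * (b p ^ j * c p ^ (j * i'))) * (b p ^ j' * c p ^ (l + l'))) := by
          rw [add_comm _ (j * i'), pow_add _ (j * i')]
          simp only [mul_assoc]
          rw [← mul_assoc (c p ^ (j * i')) (b p ^ j'), (hcb.pow_pow (j * i') j').eq, mul_assoc]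
      _ = a p ^ i * (b p ^ j * (a p ^ i' * (b p ^ j' * (c p ^ (l + l'))))) := by
          rw [← b_pow_mul_a_pow]; simp only [mul_assoc]
      _ = _ := by
          rw [pow_add]
          simp only [mul_assoc]
          rw [← mul_assoc (c p ^ l), (hca.pow_pow l i').eq, mul_assoc, ← mul_assoc (c p ^ l) (b p ^ j'),
            (hcb.pow_pow l j').eq, mul_assoc]

theorem ofModel_toModel [NeZero p] [Fact (1 < p)] (g : Heis p) : ofModel p (toModel p g) = g := by
  have h : (ofModel p).comp (toModel p) = MonoidHom.id _ := by
    refine PresentedGroup.ext fun t => ?_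
    cases t
    · change ofModel p (toModel p (a p)) = a p
      simp [ofModel, ZMod.val_one]
    · change ofModel p (toModel p (b p)) = b p
      simp [ofModel, ZMod.val_one]
    · change ofModel p (toModel p (c p)) = c p
      simp [ofModel, ZMod.val_one]
  exact DFunLike.congr_fun h g

/-- Every subgroup of the centre is normal, so the intersection lies in the core. -/
theorem disjoint_center_of_normalCore_eq_bot {H : Subgroup (Heis p)} (hH : H.normalCore = ⊥) :
    H ⊓ Subgroup.center (Heis p) = ⊥ := by
  have hn : (H ⊓ Subgroup.center (Heis p)).Normal := ⟨fun n hn g => by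
    rw [(Subgroup.mem_center_iff.1 hn.2 g), mul_inv_cancel_right]
    exact hn⟩
  exact le_bot_iff.1 (hH ▸ Subgroup.normal_le_normalCore.2 inf_le_left)

variable [hp : Fact p.Prime]

theorem toModel_injective : Function.Injective (toModel p) :=
  have : Fact (1 < p) := ⟨hp.out.one_lt⟩
  Function.LeftInverse.injective ofModel_toModel

theorem mem_center_iff (g : Heis p) :
    g ∈ Subgroup.center (Heis p) ↔ (toModel p g).x = 0 ∧ (toModel p g).y = 0 := by
  rw [Subgroup.mem_center_iff]
  constructor
  · intro h
    constructor
    · have := congrArg (fun t => (toModel p t).z) (h (b p))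
      simpa using this
    · have := congrArg (fun t => (toModel p t).z) (h (a p))
      simpa using this.symm
  · rintro ⟨hx, hy⟩ t
    refine toModel_injective ?_
    ext <;> simp [hx, hy, add_comm]

theorem center_eq_zpowers : Subgroup.center (Heis p) = Subgroup.zpowers (c p) := by
  refine le_antisymm (fun g hg => ?_) ?_
  · obtain ⟨hx, hy⟩ := (mem_center_iff g).1 hg
    refine ⟨((toModel p g).z.val : ℤ), toModel_injective ?_⟩
    change toModel p (c p ^ ((toModel p g).z.val : ℤ)) = _
    rw [zpow_natCast, map_pow]
    ext <;> simp [hx, hy, HeisModel.pow_x, HeisModel.pow_y, HeisModel.pow_z]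
  · rw [Subgroup.zpowers_le, mem_center_iff]
    simp

theorem orderOf_c : orderOf (c p) = p := by
  refine orderOf_eq_prime (c_pow p) fun h => ?_
  have := congrArg (fun t => (toModel p t).z) h
  simp at this

theorem nonempty_zpowers_mulEquiv {G : Type*} [Group G] {g : G} (hg : orderOf g = p) :
    Nonempty (Subgroup.zpowers g ≃* Multiplicative (ZMod p)) := by
  refine ⟨mulEquivOfCyclicCardEq ?_⟩
  rw [Nat.card_zpowers, hg, Nat.card_congr Multiplicative.toAdd, Nat.card_zmod]

/-- A nontrivial subgroup meeting the center trivially is generated by an element of order `p`, and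
there is a linear form on `G/Z(G)` whose value at the generator is `1`. -/
theorem exists_generator {H : Subgroup (Heis p)} (hH : H ⊓ Subgroup.center (Heis p) = ⊥)
    (hne : H ≠ ⊥) : ∃ h : Heis p, H = Subgroup.zpowers h ∧ orderOf h = p ∧
      ∃ s t : ZMod p, s * (toModel p h).x + t * (toModel p h).y = 1 := by
  obtain ⟨h, hhH, hh1⟩ := H.bot_or_exists_ne_one.resolve_left hne
  have hz : ∀ g ∈ H, (toModel p g).x = 0 → (toModel p g).y = 0 → g = 1 := fun g hg hx hy => by
    have : g ∈ H ⊓ Subgroup.center (Heis p) := ⟨hg, (mem_center_iff g).2 ⟨hx, hy⟩⟩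
    rwa [hH, Subgroup.mem_bot] at this
  -- The commutator of `h` and `g` is central and in `H`, hence trivial; its coordinate is the
  -- symplectic form on $\mathbb F_p^2$.
  have hcomm : ∀ g ∈ H, (toModel p h).y * (toModel p g).x = (toModel p g).y * (toModel p h).x := by
    intro g hg
    have h1 : h * g * h⁻¹ * g⁻¹ = 1 := by
      refine hz _ (H.mul_mem (H.mul_mem (H.mul_mem hhH hg) (H.inv_mem hhH)) (H.inv_mem hg)) ?_ ?_ <;>
        simp
    rw [mul_inv_eq_one, mul_inv_eq_iff_eq_mul] at h1
    have := congrArg (fun t => (toModel p t).z) h1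
    simp only [map_mul, HeisModel.mul_z] at this
    linear_combination this
  have hst : ∃ s t : ZMod p, s * (toModel p h).x + t * (toModel p h).y = 1 := by
    by_cases hx : (toModel p h).x = 0
    · refine ⟨0, (toModel p h).y⁻¹, ?_⟩
      rw [zero_mul, zero_add, inv_mul_cancel₀]
      exact fun hy => hh1 (hz h hhH hx hy)
    · exact ⟨(toModel p h).x⁻¹, 0, by rw [zero_mul, add_zero, inv_mul_cancel₀ hx]⟩
  refine ⟨h, le_antisymm (fun g hg => ?_) (Subgroup.zpowers_le.2 hhH), ?_, hst⟩
  · obtain ⟨s, t, hst⟩ := hst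
    have hc := hcomm g hg
    -- Isotropy makes the image of `g` proportional to that of `h`; the linear form normalised at
    -- `h` reads off the factor.
    let n : ZMod p := s * (toModel p g).x + t * (toModel p g).y
    have hg' : g * (h ^ n.val)⁻¹ = 1 := by
      refine hz _ (H.mul_mem hg (H.inv_mem (H.pow_mem hhH _))) ?_ ?_
      · simp only [map_mul, map_inv, map_pow, HeisModel.mul_x, HeisModel.inv_x, HeisModel.pow_x,
          ZMod.natCast_val, ZMod.cast_id', id_eq, n]
        linear_combination -(toModel p g).x * hst + t * hc
      · simp only [map_mul, map_inv, map_pow, HeisModel.mul_y, HeisModel.inv_y, HeisModel.pow_y,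
          ZMod.natCast_val, ZMod.cast_id', id_eq, n]
        linear_combination -(toModel p g).y * hst - s * hc
    rw [mul_inv_eq_one] at hg'
    exact hg' ▸ Subgroup.pow_mem _ (Subgroup.mem_zpowers h) _
  · refine orderOf_eq_prime (hz _ (H.pow_mem hhH p) ?_ ?_) hh1 <;>
      simp [HeisModel.pow_x, HeisModel.pow_y]

/-- A subgroup generated by an element of order `p` outside of the center is a retract. -/
theorem exists_retraction {h : Heis p} (hh : orderOf h = p) {s t : ZMod p}
    (hst : s * (toModel p h).x + t * (toModel p h).y = 1) :
    ∃ r : Heis p →* Subgroup.zpowers h, ∀ g : Subgroup.zpowers h, r g = g := by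
  let l : Heis p → ZMod p := fun g => s * (toModel p g).x + t * (toModel p g).y
  have hl : ∀ g g', l (g * g') = l g + l g' := fun g g' => by
    simp only [l, map_mul, HeisModel.mul_x, HeisModel.mul_y]; ring
  let h' : Subgroup.zpowers h := ⟨h, Subgroup.mem_zpowers h⟩
  have hh' : h' ^ p = 1 := Subtype.ext (by simpa [hh] using pow_orderOf_eq_one h)
  refine ⟨MonoidHom.mk' (fun g => h' ^ (l g).val) fun g g' => by rw [hl, pow_val_add hh'], ?_⟩
  have hfix : h' ^ (l h).val = h' := by
    have : Fact (1 < p) := ⟨hp.out.one_lt⟩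
    rw [show l h = 1 from hst, ZMod.val_one, pow_one]
  rintro ⟨g, n, rfl⟩
  have e : (⟨h ^ n, n, rfl⟩ : Subgroup.zpowers h) = h' ^ n := rfl
  change (MonoidHom.mk' (fun g => h' ^ (l g).val) _ : Heis p →* Subgroup.zpowers h) (h ^ n) = _
  rw [map_zpow, e]
  exact congrArg (· ^ n) hfix

end Heis

end HeisenbergHNP

namespace HeisenbergHNP

noncomputable section

/-! ### Central extensions and the Schur multiplier -/

section Extension

variable {G A : Type} [Group G] [AddCommGroup A]

/-- The underlying set of the central extension of `G` by `A` attached to a 2-cocycle. -/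
@[ext]
structure CocycleExt (f : groupCohomology.cocycles₂ (Rep.trivial ℤ G A)) where
  fst : A
  snd : G

namespace CocycleExt

variable (f : groupCohomology.cocycles₂ (Rep.trivial ℤ G A))

/-- A 2-cocycle as a function of two variables. -/
def coc (g h : G) : A := f (g, h)

theorem coc_mul (g h j : G) : coc f (g * h) j + coc f g h = coc f h j + coc f g (h * j) :=
  (groupCohomology.mem_cocycles₂_iff _).1 f.2 g h j

theorem coc_one_left (g : G) : coc f 1 g = coc f 1 1 := groupCohomology.cocycles₂_map_one_fst f g

theorem coc_one_right (g : G) : coc f g 1 = coc f 1 1 := groupCohomology.cocycles₂_map_one_snd f g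

instance : Mul (CocycleExt f) := ⟨fun s t => ⟨s.fst + t.fst + coc f s.snd t.snd, s.snd * t.snd⟩⟩
-- Cocycles are not normalised, hence the correction by $f(1,1)$.
instance : One (CocycleExt f) := ⟨⟨-coc f 1 1, 1⟩⟩
instance : Inv (CocycleExt f) :=
  ⟨fun s => ⟨-s.fst - coc f s.snd⁻¹ s.snd - coc f 1 1, s.snd⁻¹⟩⟩

variable {f}

theorem mul_fst (s t : CocycleExt f) : (s * t).fst = s.fst + t.fst + coc f s.snd t.snd := rfl
@[simp] theorem mul_snd (s t : CocycleExt f) : (s * t).snd = s.snd * t.snd := rfl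
theorem one_fst : (1 : CocycleExt f).fst = -coc f 1 1 := rfl
@[simp] theorem one_snd : (1 : CocycleExt f).snd = 1 := rfl

instance : Group (CocycleExt f) :=
  Group.ofLeftAxioms
    (fun s t u => CocycleExt.ext (by
      have := coc_mul f s.snd t.snd u.snd
      simp only [mul_fst, mul_snd]
      calc _ = s.fst + t.fst + u.fst + (coc f (s.snd * t.snd) u.snd + coc f s.snd t.snd) := by abel
        _ = _ := by rw [this]; abel) (mul_assoc _ _ _))
    (fun s => CocycleExt.ext (by
      rw [mul_fst, one_fst, one_snd, coc_one_left f s.snd]; abel) (one_mul _))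
    (fun s => CocycleExt.ext (by
      change -s.fst - coc f s.snd⁻¹ s.snd - coc f 1 1 + s.fst + coc f s.snd⁻¹ s.snd = -coc f 1 1
      abel) (inv_mul_cancel _))

variable (f) in
/-- The projection of the central extension. -/
def proj : CocycleExt f →* G where
  toFun := snd
  map_one' := rfl
  map_mul' _ _ := rfl

variable (f) in
/-- The central embedding of the coefficients. -/
def incl : Multiplicative A →* CocycleExt f where
  toFun x := ⟨x.toAdd - coc f 1 1, 1⟩
  map_one' := CocycleExt.ext (by simp [one_fst]) rfl
  map_mul' x y := CocycleExt.ext (by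
    change (x * y).toAdd - coc f 1 1 = x.toAdd - coc f 1 1 + (y.toAdd - coc f 1 1) + coc f 1 1
    rw [toAdd_mul]; abel) (mul_one _).symm

theorem incl_commute (x : Multiplicative A) (s : CocycleExt f) : Commute (incl f x) s :=
  CocycleExt.ext (by
    change x.toAdd - coc f 1 1 + s.fst + coc f 1 s.snd = s.fst + (x.toAdd - coc f 1 1) + coc f s.snd 1
    rw [coc_one_left f s.snd, coc_one_right f s.snd]; abel) (by simp [incl])

theorem exists_incl_eq {s : CocycleExt f} (hs : proj f s = 1) : ∃ x, incl f x = s :=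
  ⟨Multiplicative.ofAdd (s.fst + coc f 1 1), CocycleExt.ext (by simp [incl]) hs.symm⟩

/-- Elements of order dividing `n` lift to such elements if the coefficients are `n`-divisible. -/
theorem exists_lift_pow_eq_one {n : ℕ} (hA : ∀ x : A, ∃ y, n • y = x) {g : G} (hg : g ^ n = 1) :
    ∃ s : CocycleExt f, proj f s = g ∧ s ^ n = 1 := by
  let t : CocycleExt f := ⟨0, g⟩
  have ht : proj f t = g := rfl
  -- The power $t^n$ is central, so multiplying `t` by an $n$-th root of its inverse corrects the
  -- lift.
  obtain ⟨x, hx⟩ := exists_incl_eq (s := t ^ n) (by rw [map_pow, ht, hg])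
  obtain ⟨y, hy⟩ := hA (-x.toAdd)
  refine ⟨incl f (Multiplicative.ofAdd y) * t, ?_, ?_⟩
  · rw [map_mul, ht]
    exact one_mul g
  · rw [(incl_commute _ _).mul_pow, ← hx, ← map_pow, ← map_mul, ← ofAdd_nsmul, hy, ofAdd_neg,
      ofAdd_toAdd, inv_mul_cancel, map_one]

theorem commute_iff {s t : CocycleExt f} (h : Commute s.snd t.snd) :
    Commute s t ↔ coc f s.snd t.snd = coc f t.snd s.snd := by
  constructor
  · intro hst
    have := congrArg fst (hst : s * t = t * s)
    rwa [mul_fst, mul_fst, add_comm s.fst, add_left_cancel_iff] at this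
  · intro hc
    exact CocycleExt.ext (by rw [mul_fst, mul_fst, hc, add_comm s.fst]) h

/-- The cocycle of a split extension is a coboundary. -/
theorem H2π_eq_zero_of_section (σ : G →* CocycleExt f) (hσ : (proj f).comp σ = MonoidHom.id G) :
    groupCohomology.H2π _ f = 0 := by
  rw [groupCohomology.H2π_eq_zero_iff]
  have h2 : ∀ g, (σ g).snd = g := fun g => DFunLike.congr_fun hσ g
  refine ⟨fun g => -(σ g).fst, funext fun ⟨g, h⟩ => ?_⟩
  have h1 := congrArg fst (map_mul σ g h)
  rw [mul_fst, h2, h2] at h1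
  change -(σ h).fst - -(σ (g * h)).fst + -(σ g).fst = coc f g h
  rw [h1]
  abel

/-- The commutator with a lift of a central element is itself central, hence multiplicative in the
other argument. -/
theorem coc_sub_coc_mul {c : G} (hc : ∀ g, c * g = g * c) (g h : G) :
    coc f c (g * h) - coc f (g * h) c = (coc f c g - coc f g c) + (coc f c h - coc f h c) := by
  have h1 := coc_mul f c g h
  have h2 := coc_mul f g c h
  have h3 := coc_mul f g h c
  rw [hc] at h1
  rw [hc] at h2
  rw [← sub_eq_zero] at h1 h2 h3 ⊢
  have : ∀ x y z : A, x = 0 → y = 0 → z = 0 → -x + y - z = 0 := by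
    rintro _ _ _ rfl rfl rfl; simp
  rw [← this _ _ _ h1 h2 h3]
  abel

variable (f) in
/-- The commutator pairing of a 2-cocycle with a central element. -/
def pairingHom {c : G} (hc : ∀ g, c * g = g * c) : G →* Multiplicative A :=
  MonoidHom.mk' (fun g => Multiplicative.ofAdd (coc f c g - coc f g c)) fun g h => by
    rw [coc_sub_coc_mul hc, ofAdd_add]

theorem nsmul_coc_sub_coc {c : G} (hc : ∀ g, c * g = g * c) {g : G} {n : ℕ} (hg : g ^ n = 1) :
    n • (coc f c g - coc f g c) = 0 := by
  have h : pairingHom f hc g ^ n = 1 := by rw [← map_pow, hg, map_one]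
  exact h

end CocycleExt

end Extension

/-! ### Computation of the Schur multiplier of the Heisenberg group -/

section Heis

open CocycleExt

variable {p : ℕ} {A : Type} [AddCommGroup A]

theorem Heis.c_mul (g : Heis p) : Heis.c p * g = g * Heis.c p := by
  have h : g ∈ Subgroup.centralizer {Heis.c p} := by
    have hcl := PresentedGroup.closure_range_of (heisRels p)
    have hle : Subgroup.closure (Set.range (PresentedGroup.of (rels := heisRels p))) ≤
        Subgroup.centralizer {Heis.c p} := by
      rw [Subgroup.closure_le]
      rintro _ ⟨t, rfl⟩
      refine Subgroup.mem_centralizer_singleton_iff.2 ?_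
      cases t
      · exact (Heis.ca p).symm
      · exact (Heis.cb p).symm
      · rfl
    rw [hcl] at hle
    exact hle trivial
  exact (Subgroup.mem_centralizer_singleton_iff.1 h).symm

/-- The commutators of `c` with `a` and with `b` in the central extension of a 2-cocycle. -/
def commutators (p : ℕ) (A : Type) [AddCommGroup A] :
    groupCohomology.cocycles₂ (Rep.trivial ℤ (Heis p) A) →+ A × A :=
  AddMonoidHom.mk' (fun f => (coc f (Heis.c p) (Heis.a p) - coc f (Heis.a p) (Heis.c p),
    coc f (Heis.c p) (Heis.b p) - coc f (Heis.b p) (Heis.c p))) fun _ _ =>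
      Prod.ext (add_sub_add_comm _ _ _ _) (add_sub_add_comm _ _ _ _)

/-- With trivial action, a coboundary is symmetric on commuting pairs. -/
theorem commutators_eq_zero_of_H2π_eq_zero
    (f : groupCohomology.cocycles₂ (Rep.trivial ℤ (Heis p) A))
    (hf : groupCohomology.H2π _ f = 0) : commutators p A f = 0 := by
  obtain ⟨u, hu⟩ := (groupCohomology.H2π_eq_zero_iff _).1 hf
  change Heis p → A at u
  have h : ∀ g, coc f (Heis.c p) g - coc f g (Heis.c p) = 0 := by
    intro g
    have e : ∀ g h, coc f g h = u h - u (g * h) + u g := fun g h => (congrFun hu (g, h)).symm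
    rw [e, e, Heis.c_mul]
    abel
  exact Prod.ext (h _) (h _)

/-- Lift `a` and `b` to elements `s`, `t` of exponent `p`, which divisibility allows, and lift `c`
to their commutator `u`. All defining relations then hold, so the presentation gives a splitting. -/
theorem H2π_eq_zero_of_commutators_eq_zero (hA : ∀ x : A, ∃ y, p • y = x)
    (f : groupCohomology.cocycles₂ (Rep.trivial ℤ (Heis p) A)) (hf : commutators p A f = 0) :
    groupCohomology.H2π _ f = 0 := by
  obtain ⟨s, hs, hsp⟩ := exists_lift_pow_eq_one (f := f) hA (Heis.a_pow p)
  obtain ⟨t, ht, htp⟩ := exists_lift_pow_eq_one (f := f) hA (Heis.b_pow p)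
  let u := t⁻¹ * s⁻¹ * t * s
  have hu : proj f u = Heis.c p := by
    simp only [u, map_mul, map_inv, hs, ht]
    rw [mul_assoc, Heis.ba]
    group
  have hus : Commute u s := by
    refine (commute_iff ?_).2 ?_
    · change proj f u * proj f s = proj f s * proj f u
      rw [hu, hs, Heis.ca]
    · change coc f (proj f u) (proj f s) = coc f (proj f s) (proj f u)
      rw [hu, hs]
      exact sub_eq_zero.1 (congrArg Prod.fst hf)
  have hut : Commute u t := by
    refine (commute_iff ?_).2 ?_
    · change proj f u * proj f t = proj f t * proj f u
      rw [hu, ht, Heis.cb]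
    · change coc f (proj f u) (proj f t) = coc f (proj f t) (proj f u)
      rw [hu, ht]
      exact sub_eq_zero.1 (congrArg Prod.snd hf)
  have hts : t * s = s * (t * u) := by simp only [u]; group
  have hpow : ∀ n : ℕ, t * s ^ n = s ^ n * (t * u ^ n) := by
    intro n
    induction n with
    | zero => simp
    | succ n ih =>
      rw [pow_succ, ← mul_assoc, ih, mul_assoc, mul_assoc, (hus.pow_left n).eq, ← mul_assoc t, hts,
        pow_succ' u]
      simp only [mul_assoc]
  -- No adjustment of `u` is needed: moving `t` past $s^p=1$ produces $u^p$.
  have hup : u ^ p = 1 := by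
    have := hpow p
    rwa [hsp, one_mul, mul_one, left_eq_mul] at this
  let gen : HeisGen → CocycleExt f := fun x => match x with
    | .a => s
    | .b => t
    | .c => u
  have hgen : ∀ r ∈ heisRels p, FreeGroup.lift gen r = 1 := by
    intro r hr
    simp only [heisRels, Set.mem_insert_iff, Set.mem_singleton_iff] at hr
    rcases hr with rfl | rfl | rfl | rfl | rfl | rfl <;>
      simp only [map_mul, map_inv, map_pow, FreeGroup.lift_apply_of, gen]
    · exact hsp
    · exact htp
    · exact hup
    · simp only [u]; group
    · rw [mul_assoc, hus.eq]; group
    · rw [mul_assoc, hut.eq]; group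
  refine H2π_eq_zero_of_section (PresentedGroup.toGroup hgen) (PresentedGroup.ext fun x => ?_)
  simp only [MonoidHom.comp_apply, PresentedGroup.toGroup.of, MonoidHom.id_apply]
  cases x
  · exact hs
  · exact ht
  · exact hu

/-- The cocycle of an extension in which `c` commutes with `b` but not with `a`. -/
def cocycleCA (θ : ZMod p →+ A) {e : ZMod p} (he : 2 * e = 1) :
    groupCohomology.cocycles₂ (Rep.trivial ℤ (Heis p) A) :=
  -- Impose $ca=acw$ with $w$ central and collect: the exponent of $w$ is $zx'+y\binom{x'}2$. Its
  -- term $-yx'/2$ is dropped, since $yx'$ is a coboundary up to sign (of the coordinate $z$).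
  ⟨fun gh => θ ((Heis.toModel p gh.1).z * (Heis.toModel p gh.2).x +
      e * ((Heis.toModel p gh.1).y * (Heis.toModel p gh.2).x ^ 2)), by
    rw [groupCohomology.mem_cocycles₂_iff]
    intro g h j
    change θ _ + θ _ = θ _ + θ _
    rw [← map_add, ← map_add]
    refine congrArg θ ?_
    simp only [map_mul, HeisModel.mul_x, HeisModel.mul_y, HeisModel.mul_z]
    linear_combination -((Heis.toModel p g).y * (Heis.toModel p h).x * (Heis.toModel p j).x) * he⟩

/-- The cocycle of an extension in which `c` commutes with `a` but not with `b`. -/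
def cocycleCB (θ : ZMod p →+ A) {e : ZMod p} (he : 2 * e = 1) :
    groupCohomology.cocycles₂ (Rep.trivial ℤ (Heis p) A) :=
  -- Likewise with $cb=bcw$: the exponent is $(z+yx')y'+x'\binom y2$, modulo the same coboundary.
  ⟨fun gh => θ (((Heis.toModel p gh.1).z + (Heis.toModel p gh.1).y * (Heis.toModel p gh.2).x) *
      (Heis.toModel p gh.2).y + e * ((Heis.toModel p gh.1).y ^ 2 * (Heis.toModel p gh.2).x)), by
    rw [groupCohomology.mem_cocycles₂_iff]
    intro g h j
    change θ _ + θ _ = θ _ + θ _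
    rw [← map_add, ← map_add]
    refine congrArg θ ?_
    simp only [map_mul, HeisModel.mul_x, HeisModel.mul_y, HeisModel.mul_z]
    linear_combination ((Heis.toModel p g).y * (Heis.toModel p h).y * (Heis.toModel p j).x) * he⟩

theorem cocycleCA_apply (θ : ZMod p →+ A) {e : ZMod p} (he : 2 * e = 1) (g h : Heis p) :
    coc (cocycleCA θ he) g h = θ ((Heis.toModel p g).z * (Heis.toModel p h).x +
      e * ((Heis.toModel p g).y * (Heis.toModel p h).x ^ 2)) := rfl

theorem cocycleCB_apply (θ : ZMod p →+ A) {e : ZMod p} (he : 2 * e = 1) (g h : Heis p) :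
    coc (cocycleCB θ he) g h =
      θ (((Heis.toModel p g).z + (Heis.toModel p g).y * (Heis.toModel p h).x) *
        (Heis.toModel p h).y + e * ((Heis.toModel p g).y ^ 2 * (Heis.toModel p h).x)) := rfl

theorem commutators_cocycleCA (θ : ZMod p →+ A) {e : ZMod p} (he : 2 * e = 1) :
    commutators p A (cocycleCA θ he) = (θ 1, 0) := by
  refine Prod.ext ?_ ?_ <;> simp [commutators, cocycleCA_apply]

theorem commutators_cocycleCB (θ : ZMod p →+ A) {e : ZMod p} (he : 2 * e = 1) :
    commutators p A (cocycleCB θ he) = (0, θ 1) := by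
  refine Prod.ext ?_ ?_ <;> simp [commutators, cocycleCB_apply]

/-- Since $a^p=b^p=1$, bilinearity makes both commutators $p$-torsion, hence values of `θ`; the two
explicit cocycles generate all such pairs. -/
theorem range_commutators (θ : ZMod p →+ A) (hθ : ∀ x : A, p • x = 0 → x ∈ θ.range)
    {e : ZMod p} (he : 2 * e = 1) :
    (commutators p A).range = (θ.prodMap θ).range := by
  refine le_antisymm ?_ ?_
  · rintro _ ⟨f, rfl⟩
    obtain ⟨s, hs⟩ := hθ _ (nsmul_coc_sub_coc (f := f) Heis.c_mul (Heis.a_pow p))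
    obtain ⟨t, ht⟩ := hθ _ (nsmul_coc_sub_coc (f := f) Heis.c_mul (Heis.b_pow p))
    exact ⟨(s, t), Prod.ext hs ht⟩
  · rintro _ ⟨⟨s, t⟩, rfl⟩
    obtain ⟨m, rfl⟩ := ZMod.intCast_surjective s
    obtain ⟨n, rfl⟩ := ZMod.intCast_surjective t
    refine ⟨m • cocycleCA θ he + n • cocycleCB θ he, ?_⟩
    rw [map_add, map_zsmul, map_zsmul, commutators_cocycleCA, commutators_cocycleCB]
    simp [← map_zsmul]

theorem nonempty_groupCohomology_two_addEquiv (hA : ∀ x : A, ∃ y, p • y = x) (θ : ZMod p →+ A)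
    (hθ : Function.Injective θ) (hθ' : ∀ x : A, p • x = 0 → x ∈ θ.range)
    {e : ZMod p} (he : 2 * e = 1) :
    Nonempty (groupCohomology (Rep.trivial ℤ (Heis p) A) 2 ≃+ ZMod p × ZMod p) := by
  let π := (groupCohomology.H2π (Rep.trivial ℤ (Heis p) A)).hom.toAddMonoidHom
  have hπ : Function.Surjective π :=
    (ModuleCat.epi_iff_surjective (groupCohomology.H2π (Rep.trivial ℤ (Heis p) A))).1 inferInstance
  have hker : π.ker = (commutators p A).ker :=
    AddSubgroup.ext fun f => ⟨commutators_eq_zero_of_H2π_eq_zero f,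
      H2π_eq_zero_of_commutators_eq_zero hA f⟩
  exact ⟨(QuotientAddGroup.quotientKerEquivOfSurjective π hπ).symm.trans <|
    (QuotientAddGroup.quotientAddEquivOfEq hker).trans <|
    (QuotientAddGroup.quotientKerEquivRange (commutators p A)).trans <|
    (AddEquiv.addSubgroupCongr (range_commutators θ hθ' he)).trans
    (AddMonoidHom.ofInjective (f := θ.prodMap θ) (hθ.prodMap hθ)).symm⟩

theorem exists_zmod_hom_units_complex (p : ℕ) [NeZero p] : ∃ θ : ZMod p →+ Additive ℂˣ,
    Function.Injective θ ∧ ∀ x : Additive ℂˣ, p • x = 0 → x ∈ θ.range := by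
  obtain ⟨ζ, hζ⟩ : ∃ ζ : ℂˣ, IsPrimitiveRoot ζ p :=
    ⟨_, (Complex.isPrimitiveRoot_exp p (NeZero.ne p)).isUnit_unit (NeZero.ne p)⟩
  refine ⟨(Subgroup.zpowers ζ).subtype.toAdditive.comp hζ.zmodEquivZPowers.toAddMonoidHom, ?_, ?_⟩
  · exact Subtype.val_injective.comp hζ.zmodEquivZPowers.injective
  · intro x hx
    have hx' : x.toMul ∈ Subgroup.zpowers ζ := by
      rw [hζ.zpowers_eq]
      exact hx
    obtain ⟨i, hi⟩ := hζ.zmodEquivZPowers.surjective (Additive.ofMul ⟨x.toMul, hx'⟩)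
    exact ⟨i, congrArg (fun y => Additive.ofMul (y.toMul : ℂˣ)) hi⟩

theorem exists_nsmul_eq_units_complex {n : ℕ} (hn : n ≠ 0) (x : Additive ℂˣ) : ∃ y, n • y = x := by
  obtain ⟨z, hz⟩ := IsAlgClosed.exists_pow_nat_eq (x.toMul : ℂ) (Nat.pos_of_ne_zero hn)
  have hz0 : z ≠ 0 := by
    rintro rfl
    rw [zero_pow hn] at hz
    exact x.toMul.ne_zero hz.symm
  exact ⟨Additive.ofMul (Units.mk0 z hz0), congrArg Additive.ofMul (Units.ext hz)⟩

theorem nonempty_schurMultiplier_addEquiv [hp : Fact p.Prime] (hp3 : 3 ≤ p) :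
    Nonempty (schurMultiplier (Heis p) ≃+ ZMod p × ZMod p) := by
  obtain ⟨θ, hθ, hθ'⟩ := exists_zmod_hom_units_complex p
  -- Oddness of `p` provides the constant $e=1/2$ of the explicit cocycles.
  have h2 : (2 : ZMod p) ≠ 0 := fun h => by
    have : p ∣ 2 := (ZMod.natCast_eq_zero_iff 2 p).1 (by exact_mod_cast h)
    exact absurd (Nat.le_of_dvd two_pos this) (by omega)
  exact nonempty_groupCohomology_two_addEquiv (exists_nsmul_eq_units_complex hp.out.ne_zero) θ hθ hθ'
    (mul_inv_cancel₀ h2)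

end Heis

end

end HeisenbergHNP

/-! ### Galois theory and conclusion -/

namespace HeisenbergHNP

/-- The subgroup attached to a field has trivial core in the automorphism group of its normal
closure. -/
theorem normalCore_range_restrictScalarsHom {k K L : Type*} [Field k] [Field K] [Field L]
    [Algebra k K] [Algebra K L] [Algebra k L] [IsScalarTower k K L] [IsNormalClosure k K L] :
    (AlgEquiv.restrictScalarsHom k : Gal(L/K) →* Gal(L/k)).range.normalCore = ⊥ := by
  rw [eq_bot_iff]
  intro σ hσ
  rw [Subgroup.mem_bot]
  -- All conjugates of `σ` fix `K`, so `σ` fixes every conjugate $\tau(K)$; these generate the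
  -- normal closure.
  have hfix : ∀ τ : Gal(L/k), ∀ x : K, σ (τ (algebraMap K L x)) = τ (algebraMap K L x) := by
    intro τ x
    obtain ⟨ρ, hρ⟩ : τ⁻¹ * σ * τ⁻¹⁻¹ ∈
      (AlgEquiv.restrictScalarsHom k : Gal(L/K) →* Gal(L/k)).range := hσ τ⁻¹
    have h1 := DFunLike.congr_fun hρ (algebraMap K L x)
    have h2 : (AlgEquiv.restrictScalarsHom k ρ : Gal(L/k)) (algebraMap K L x) = algebraMap K L x :=
      ρ.commutes x
    rw [h2, inv_inv] at h1
    have h3 : τ⁻¹ (σ (τ (algebraMap K L x))) = algebraMap K L x := h1.symm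
    exact (τ.apply_symm_apply _).symm.trans (congrArg τ h3)
  have : Normal k L := IsNormalClosure.normal (F := k) (K := K) (L := L)
  have hE : IntermediateField.fixedField (Subgroup.zpowers σ) = ⊤ := by
    rw [eq_top_iff, ← IsNormalClosure.adjoin_rootSet (F := k) (K := K) (L := L), iSup_le_iff]
    intro x
    rw [IntermediateField.adjoin_le_iff]
    intro y hy
    have hx : IsIntegral k (algebraMap K L x) := Normal.isIntegral this _
    have hroot : Polynomial.aeval y (minpoly k (algebraMap K L x)) = 0 := by
      rw [minpoly.algebraMap_eq (algebraMap K L).injective]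
      exact (Polynomial.mem_rootSet.1 hy).2
    obtain ⟨τ, rfl⟩ := minpoly.exists_algEquiv_of_root' hx.isAlgebraic hroot
    have hle : Subgroup.zpowers σ ≤ MulAction.stabilizer Gal(L/k) (τ (algebraMap K L x)) :=
      Subgroup.zpowers_le.2 (hfix τ x)
    exact (IntermediateField.mem_fixedField_iff _ _).2 fun f hf => hle hf
  refine AlgEquiv.ext fun y => ?_
  have hy : y ∈ IntermediateField.fixedField (Subgroup.zpowers σ) := hE ▸ trivial
  exact (IntermediateField.mem_fixedField_iff _ _).1 hy σ (Subgroup.mem_zpowers σ)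

end HeisenbergHNP

theorem proposition2p2 (p : ℕ) [Fact p.Prime] (hp : 3 ≤ p)
    {k K L : Type*} [Field k] [Field K] [Field L] [Algebra k K] [Algebra K L] [Algebra k L]
    [IsScalarTower k K L] [FiniteDimensional k K] [Algebra.IsSeparable k K]
    [IsNormalClosure k K L]
    -- an identification of `Gal(L/k)` with `G = E_p(p³)`; `H` is the image of `Gal(L/K)`
    (φ : Gal(L/k) ≃* HeisenbergHNP.Heis p) (H : Subgroup (HeisenbergHNP.Heis p))
    (hH : H = ((AlgEquiv.restrictScalarsHom k : Gal(L/K) →* Gal(L/k)).range).map φ.toMonoidHom) :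
    -- `Z(G) = ⟨c⟩ ≅ C_p`
    (Subgroup.center (HeisenbergHNP.Heis p) = Subgroup.zpowers (HeisenbergHNP.Heis.c p) ∧
      Nonempty (Subgroup.center (HeisenbergHNP.Heis p) ≃* Multiplicative (ZMod p))) ∧
    -- `H = 1`, or `H ≅ C_p` and `H ≠ Z(G)`
    (H = ⊥ ∨ (Nonempty (H ≃* Multiplicative (ZMod p)) ∧
      H ≠ Subgroup.center (HeisenbergHNP.Heis p))) ∧
    -- the case `H = 1`
    (H = ⊥ →
      HeisenbergHNP.shaOmega (HeisenbergHNP.chevalley ℤ H) = ⊤ ∧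
      IsIso (HeisenbergHNP.connecting ℤ H) ∧
      Nonempty (groupCohomology (Rep.trivial ℤ (HeisenbergHNP.Heis p) ℤ) 3 ≃+
        HeisenbergHNP.schurMultiplier (HeisenbergHNP.Heis p)) ∧
      Nonempty (HeisenbergHNP.schurMultiplier (HeisenbergHNP.Heis p) ≃+ ZMod p × ZMod p)) ∧
    -- the case `H ≅ C_p`, `H ≠ Z(G)`
    (Nonempty (H ≃* Multiplicative (ZMod p)) →
      H ≠ Subgroup.center (HeisenbergHNP.Heis p) →
      IsIso (HeisenbergHNP.connecting ℤ H) ∧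
      Nonempty (groupCohomology (Rep.trivial ℤ (HeisenbergHNP.Heis p) ℤ) 3 ≃+
        HeisenbergHNP.schurMultiplier (HeisenbergHNP.Heis p)) ∧
      Nonempty (HeisenbergHNP.schurMultiplier (HeisenbergHNP.Heis p) ≃+ ZMod p × ZMod p)) := by
  open HeisenbergHNP in
  have hcore : H.normalCore = ⊥ := by
    rw [eq_bot_iff]
    intro g hg
    have hmem : φ.symm g ∈
        (AlgEquiv.restrictScalarsHom k : Gal(L/K) →* Gal(L/k)).range.normalCore := by
      intro τ
      have h1 : φ τ * g * (φ τ)⁻¹ ∈ H := hg (φ τ)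
      rw [hH] at h1
      obtain ⟨ρ, hρ, e⟩ := h1
      have : ρ = τ * φ.symm g * τ⁻¹ := φ.injective (by simpa using e)
      exact this ▸ hρ
    rw [normalCore_range_restrictScalarsHom, Subgroup.mem_bot] at hmem
    rw [Subgroup.mem_bot]
    exact φ.symm.injective (hmem.trans (map_one _).symm)
  have hdisj := Heis.disjoint_center_of_normalCore_eq_bot hcore
  have hcenter := Heis.center_eq_zpowers (p := p)
  have hM := nonempty_addEquiv_schurMultiplier (G := Heis p)
  have hM' := nonempty_schurMultiplier_addEquiv hp
  have hcard := Heis.nonempty_zpowers_mulEquiv (Heis.orderOf_c (p := p))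
  have hnecenter : H ≠ Subgroup.center (Heis p) := by
    intro h
    rw [h, inf_idem, hcenter, Subgroup.zpowers_eq_bot] at hdisj
    have := Heis.orderOf_c (p := p)
    rw [hdisj, orderOf_one] at this
    omega
  -- Both cases need only a retraction onto a cyclic `H`; for trivial `H` it is the trivial map.
  have hiso : IsIso (connecting ℤ H) := by
    by_cases hbot : H = ⊥
    · subst hbot
      exact isIso_connecting 1 fun h => Subsingleton.elim _ _
    · obtain ⟨h, rfl, ho, s, t, hst⟩ := Heis.exists_generator hdisj hbot
      obtain ⟨r, hr⟩ := Heis.exists_retraction ho hst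
      exact isIso_connecting r hr
  refine ⟨⟨hcenter, hcenter ▸ hcard⟩, ?_, ?_, fun _ _ => ⟨hiso, hM, hM'⟩⟩
  · refine or_iff_not_imp_left.2 fun hbot => ⟨?_, hnecenter⟩
    obtain ⟨h, rfl, ho, -⟩ := Heis.exists_generator hdisj hbot
    exact Heis.nonempty_zpowers_mulEquiv ho
  · intro hbot
    refine ⟨?_, hiso, hM, hM'⟩
    subst hbot
    exact shaOmega_bot
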